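/- A combinatorial map $M$ consists of a finite connected cubic graph $C_M$ (multiple edges allowed) whose edge set is partitioned into three perfect matchings, the $v$-edges, the $f$-edges and the $a$-edges, such that every component of the union of the $v$-edges and the $f$-edges is a polygon with four edges (a square). The diagonals of the squares form a fourth perfect matching, the $z$-edges. For $t\in\{v,f,z\}$, a $t$-gon is a component of the union of the $a$-edges and the $t$-edges. Let $E$ be the set of squares. The graph $G_M$ has the $v$-gons as vertices and $E$ as edge set, the ends of a square being the two (possibly equal) $v$-gons that contain its two $v$-edges. The dual map $D$ is obtained from $M$ by interchanging the $v$-edges and the $f$-edges; so $G_D$ has the $f$-gons as vertices and the same edge set $E$, and $M$ and $D$ have the same $z$-gons. Let $\mathcal V,\mathcal V^\perp$ be the bond space and the cycle space of $G_M$, and $\mathcal F,\mathcal F^\perp$ the bond space and the cycle space of $G_D$, as subspaces of the $GF(2)$-vector space $\mathcal E$ of all subsets of $E$ (with symmetric difference as addition). Let $v$ and $f$ be the numbers of $v$-gons and of $f$-gons. Let $\mathrm{Surf}(M,D)$ be the closed surface obtained from disjoint closed disks bounded by the $v$-gons, the $f$-gons and the squares by gluing them along the edges of $C_M$, and let $\xi=2-\chi$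 be its connectivity, where $\chi$ is its Euler characteristic. Suppose that $M$ has exactly one $z$-gon. Going around it, and recording for every $z$-edge traversed the square that contains it, gives a cyclic sequence in which every $x\in E$ occurs exactly twice; every occurrence of $x$ traverses the edge $x$ of $G_M$, and the edge $x$ of $G_D$, from one end to the other. For $x\in E$ let $i(x)$ be the set of the edges that occur exactly once between the two occurrences of $x$. Let $\kappa_P(x)=\{x\}$ if the two occurrences traverse the edge $x$ of $G_M$ in the same direction and $\kappa_P(x)=\emptyset$ otherwise; let $\kappa_{P^\sim}(x)$ be defined in the same way with $G_D$ in place of $G_M$. Let $c_P,c_{P^\sim}:\mathcal E\to\mathcal E$ be the linear maps with $c_P(\{x\})=\kappa_P(x)+i(x)$ and $c_{P^\sim}(\{x\})=\kappa_{P^\sim}(x)+i(x)$ for all $x\in E$. Then (a) $\dim \mathrm{Im}(c_{P^\sim}\circ c_P)=\xi(\mathrm{Surf}(M,D))=|E|+2-v-f$; (b) $\mathrm{Im}(c_{P^\sim}\circ c_P)=\mathcal V^\perp\cap\mathcal F^\perp$; (c) $\mathrm{Ker}(c_{P^\sim}\circ c_P)=\mathcal V+\mathcal F$. -/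

import Mathlib

open scoped Classical in
/-- The indicator vector over `GF(2)` of a set of edges.  The power set of `E`, with symmetric
difference as addition, is the space `E → ZMod 2` through this identification. -/
noncomputable def edgeVec {E : Type*} (S : Set E) : E → ZMod 2 :=
  fun e => if e ∈ S then 1 else 0

/-- The bond of a set `W` of vertices: the edges with one end in `W` and one end outside `W`. -/
def graphBond {V E : Type*} (G : Graph V E) (W : Set V) : Set E :=
  {e | ∃ p ∈ W, ∃ q ∈ G.vertexSet \ W, G.IsLink e p q}

/-- The bond space over `GF(2)`: the subspace spanned by the bonds of all sets of vertices. -/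
noncomputable def bondSpace {V E : Type*} (G : Graph V E) : Submodule (ZMod 2) (E → ZMod 2) :=
  Submodule.span (ZMod 2) {X | ∃ W : Set V, W ⊆ G.vertexSet ∧ X = edgeVec (graphBond G W)}

open scoped Classical in
/-- The cycle space over `GF(2)`: the sets of edges in which every vertex has even degree.
A loop adds two to the degree of its vertex, so only the other edges are counted. -/
noncomputable def cycleSpace {V E : Type*} [Fintype E] (G : Graph V E) :
    Submodule (ZMod 2) (E → ZMod 2) where
  carrier := {X | ∀ p ∈ G.vertexSet, ∑ e with G.IsNonloopAt e p, X e = 0}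
  zero_mem' := by
    intro p _
    simp
  add_mem' := by
    intro X Y hX hY p hp
    simp only [Pi.add_apply, Finset.sum_add_distrib, hX p hp, hY p hp, add_zero]
  smul_mem' := by
    intro r X hX p hp
    simp only [Pi.smul_apply, smul_eq_mul, ← Finset.mul_sum, hX p hp, mul_zero]

/-- The set of components of the graph on `C` in which every `x` is joined to `s x` and `t x`. -/
def PolygonSet {C : Type*} (s t : C → C) : Type _ :=
  Quot (fun x y => y = s x ∨ y = t x)

/-- The set of edges of the perfect matching which matches every `x` with `s x`. -/
def MatchingEdges {C : Type*} (s : C → C) : Type _ :=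
  Quot (fun x y => y = s x)

/-- A combinatorial map.  `C` is the set of vertices of the cubic graph `C_M`, whose edges are
the pairs `{x, v x}`, `{x, f x}` and `{x, a x}`: the three perfect matchings are given by the
involutions `v`, `f`, `a` without fixed points (pairs of different matchings may coincide, which
gives a double edge).  The components of the union of the `v`-edges and the `f`-edges are polygons
with four edges, `x, v x, f (v x) = v (f x), f x`, and `C_M` is connected.  The set of
these squares (equivalently, of the rectangles with their diagonals) is identified with the set `E`
by means of `edge`, which sends a vertex of `C_M` to the square that contains it. -/
structure CombMap (C E : Type*) where
  v : C → C
  f : C → C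
  a : C → C
  v_invol : ∀ x, v (v x) = x
  f_invol : ∀ x, f (f x) = x
  a_invol : ∀ x, a (a x) = x
  v_ne : ∀ x, v x ≠ x
  f_ne : ∀ x, f x ≠ x
  a_ne : ∀ x, a x ≠ x
  square : ∀ x, v (f x) = f (v x)
  v_ne_f : ∀ x, v x ≠ f x
  nonempty : Nonempty C
  connected : ∀ x y, Relation.EqvGen (fun x y => y = v x ∨ y = f x ∨ y = a x) x y
  edge : C → E
  edge_surj : Function.Surjective edge
  edge_eq : ∀ x y, edge x = edge y ↔ (y = x ∨ y = v x ∨ y = f x ∨ y = v (f x))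

namespace CombMap

variable {C E : Type*}

/-- The matching formed by the diagonals of the squares. -/
def z (M : CombMap C E) (x : C) : C := M.v (M.f x)

/-- The dual map: short and long sides of all the rectangles are interchanged. -/
def dual (M : CombMap C E) : CombMap C E where
  v := M.f
  f := M.v
  a := M.a
  v_invol := M.f_invol
  f_invol := M.v_invol
  a_invol := M.a_invol
  v_ne := M.f_ne
  f_ne := M.v_ne
  a_ne := M.a_ne
  square x := (M.square x).symm
  v_ne_f x := (M.v_ne_f x).symm
  nonempty := M.nonempty
  connected x y := (M.connected x y).mono (by tauto)
  edge := M.edge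
  edge_surj := M.edge_surj
  edge_eq x y := by rw [M.edge_eq, ← M.square]; tauto

/-- The phial map: short sides and diagonals of all the rectangles are interchanged. -/
def phial (M : CombMap C E) : CombMap C E where
  v := M.z
  f := M.f
  a := M.a
  v_invol x := by simp only [z, M.square, M.f_invol, M.v_invol]
  f_invol := M.f_invol
  a_invol := M.a_invol
  v_ne x h := M.v_ne_f x (by
    have h' := congrArg M.v h
    simpa only [z, M.v_invol] using h'.symm)
  f_ne := M.f_ne
  a_ne := M.a_ne
  square x := by simp only [z, M.square]
  v_ne_f x h := M.v_ne (M.f x) h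
  nonempty := M.nonempty
  connected x y := by
    have key : ∀ x y, Relation.EqvGen (fun x y => y = M.v x ∨ y = M.f x ∨ y = M.a x) x y →
        Relation.EqvGen (fun x y => y = M.z x ∨ y = M.f x ∨ y = M.a x) x y := by
      intro x y h
      induction h with
      | rel x y h =>
        rcases h with rfl | h
        · refine .trans _ (M.f x) _ (.rel _ _ (Or.inr (Or.inl rfl))) (.rel _ _ (Or.inl ?_))
          simp only [z, M.f_invol]
        · exact .rel _ _ (Or.inr h)
      | refl x => exact .refl x
      | symm x y _ ih => exact .symm _ _ ih
      | trans x y w _ _ ih₁ ih₂ => exact .trans _ _ _ ih₁ ih₂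
    exact key x y (M.connected x y)
  edge := M.edge
  edge_surj := M.edge_surj
  edge_eq x y := by
    rw [M.edge_eq]
    simp only [z, M.f_invol]
    tauto

/-- The antimap: long sides and diagonals of all the rectangles are interchanged. -/
def antimap (M : CombMap C E) : CombMap C E := M.dual.phial.dual

/-- The phial of the dual is the antimap of the phial. -/
lemma dual_phial (M : CombMap C E) : M.dual.phial = M.phial.antimap := by
  have h₁ : M.dual.phial.v = M.phial.antimap.v := by
    funext x
    simp only [antimap, phial, dual, z, M.square]
  have h₂ : M.dual.phial.f = M.phial.antimap.f := by
    funext x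
    simp only [antimap, phial, dual, z, M.square, M.f_invol]
  have h₃ : M.dual.phial.a = M.phial.antimap.a := rfl
  have h₄ : M.dual.phial.edge = M.phial.antimap.edge := rfl
  revert h₁ h₂ h₃ h₄
  generalize M.dual.phial = A
  generalize M.phial.antimap = B
  cases A
  cases B
  rintro h₁ h₂ h₃ h₄
  simp only at h₁ h₂ h₃ h₄
  subst h₁ h₂ h₃ h₄
  rfl

/-- The `v`-gons: the components of the union of the `a`-edges and the `v`-edges. -/
def VGon (M : CombMap C E) : Type _ := PolygonSet M.a M.v

/-- The `f`-gons: the components of the union of the `a`-edges and the `f`-edges. -/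
def FGon (M : CombMap C E) : Type _ := PolygonSet M.a M.f

/-- The `z`-gons: the components of the union of the `a`-edges and the `z`-edges. -/
def ZGon (M : CombMap C E) : Type _ := PolygonSet M.a M.z

/-- The `v`-gon that contains a given vertex of `C_M`. -/
def vgon (M : CombMap C E) (x : C) : M.VGon := Quot.mk _ x

lemma vgon_v (M : CombMap C E) (x : C) : M.vgon (M.v x) = M.vgon x :=
  (Quot.sound (r := fun x y => y = M.a x ∨ y = M.v x) (Or.inr rfl)).symm

/-- The graph `G_M` induced by `M`: its vertices are the `v`-gons, its edges are the squares, and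
the ends of a square are the two `v`-gons (possibly equal) which contain its two `v`-edges
`{x, v x}` and `{f x, v (f x)}`. -/
def inducedGraph (M : CombMap C E) : Graph M.VGon E where
  vertexSet := Set.univ
  IsLink e p q := ∃ x, M.edge x = e ∧ M.vgon x = p ∧ M.vgon (M.f x) = q
  isLink_symm := by
    rintro e -
    refine ⟨?_⟩
    rintro p q ⟨x, hx, hp, hq⟩
    refine ⟨M.f x, ?_, hq, by rw [M.f_invol, hp]⟩
    rw [← hx, eq_comm, M.edge_eq]
    tauto
  eq_or_eq_of_isLink_of_isLink := by
    rintro e p q p' q' ⟨x, hx, rfl, rfl⟩ ⟨y, hy, rfl, rfl⟩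
    rcases (M.edge_eq x y).1 (hx.trans hy.symm) with rfl | rfl | rfl | rfl
    · exact Or.inl rfl
    · exact Or.inl (M.vgon_v x).symm
    · exact Or.inr (by rw [M.f_invol])
    · exact Or.inr (by rw [M.square, M.f_invol, M.vgon_v])
  left_mem_of_isLink := by
    intros
    exact Set.mem_univ _

/-- `M` has exactly one `z`-gon. -/
def HasOneZGon (M : CombMap C E) : Prop := Nat.card M.ZGon = 1

/-- One step along a `z`-gon: the `z`-edge from `x` to `z x` is traversed, and then the `a`-edge
from `z x`.  Each traversal of a `z`-edge is one passage of the zigzag through the square of `x`.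
In `G_M` this passage leads from the end of that edge given by its short side `{x, v x}` to the end
given by its other short side. -/
def zigzagStep (M : CombMap C E) (x : C) : C := M.a (M.z x)

/-- If the zigzag enters a square at `x`, then after `n` steps it enters this square again, for
the first time. -/
def IsReturn (M : CombMap C E) (x : C) (n : ℕ) : Prop :=
  0 < n ∧ M.edge (M.zigzagStep^[n] x) = M.edge x ∧
    ∀ k, 0 < k → k < n → M.edge (M.zigzagStep^[k] x) ≠ M.edge x

/-- `i_P(e)`, where `P` is the phial of `M`: the set of the edges which occur exactly once in the
cyclic sequence of the edges along the zigzag of `M`, between the two occurrences of `e`. -/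
def iPhial (M : CombMap C E) (e : E) : Set E :=
  {e' | ∃ x n, M.edge x = e ∧ M.IsReturn x n ∧
    ∃! k, 0 < k ∧ k < n ∧ M.edge (M.zigzagStep^[k] x) = e'}

/-- `κ_P(e)`, where `P` is the phial of `M`: it is `{e}` if the zigzag of `M` traverses the edge
`e` of `G_M` twice in the same direction, that is, both passages start at the same short side
of the square, and it is empty otherwise. -/
def kappaPhial (M : CombMap C E) (e : E) : Set E :=
  {e' | e' = e ∧ ∃ x n, M.edge x = e ∧ M.IsReturn x n ∧
    (M.zigzagStep^[n] x = x ∨ M.zigzagStep^[n] x = M.v x)}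

/-- `c_P = κ_P + i_P`, extended linearly from the singletons, where `P` is the phial of `M`.  The
phial of the dual of `M` is the antimap of `P`, hence `c_{P~}` is `M.dual.cPhial`. -/
noncomputable def cPhial [Fintype E] (M : CombMap C E) :
    (E → ZMod 2) →ₗ[ZMod 2] (E → ZMod 2) :=
  Fintype.linearCombination (ZMod 2)
    (fun e => edgeVec (M.kappaPhial e) + edgeVec (M.iPhial e))

/-- The cells, by dimension, of the closed surface `Surf(M, D)`, which is obtained from disjoint
closed disks bounded by the `v`-gons, the `f`-gons and the squares, glued along the edges
of `C_M`: the 0-cells are the vertices of `C_M`, the 1-cells are the edges of `C_M`, and the 2-cells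
are the disks. -/
def SurfCell (M : CombMap C E) : Fin 3 → Type _
  | 0 => C
  | 1 => MatchingEdges M.v ⊕ MatchingEdges M.f ⊕ MatchingEdges M.a
  | 2 => M.VGon ⊕ M.FGon ⊕ PolygonSet M.v M.f

/-- The Euler characteristic of `Surf(M, D)`. -/
noncomputable def surfEulerChar (M : CombMap C E) : ℤ :=
  ∑ i : Fin 3, (-1) ^ (i : ℕ) * (Nat.card (M.SurfCell i) : ℤ)

/-- The connectivity `ξ = 2 - χ` of `Surf(M, D)`. -/
noncomputable def connectivity (M : CombMap C E) : ℤ := 2 - M.surfEulerChar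

end CombMap

/-!
The argument runs through potentials.  For a set `X` of edges, a potential is a function `φ` with
values in `GF(2)` on the vertices of `C_M` that is constant on `a`-edges and changes along a
`z`-edge by the value of `X` at the square of this edge.  With a single `z`-gon, a potential exists,
since the zigzag traverses every square twice (`HasOneZGon.exists_isPotential`), and it is unique up
to a constant (`IsPotential.add_eq`).

The key formula is `(c_P X)(e) = φ (v x) + φ x` for any vertex `x` of the square `e`
(`HasOneZGon.cPhial_apply`): the right hand side adds up `X` along the zigzag between its two
passages through `e`, and the term `κ_P` accounts for the passage through `e` itself.  This sum is
the pairing of `X` with the vector `c_P({e})`, hence a value of the transpose of `c_P`; that the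
matrix of `c_P` is symmetric is a summation by parts along the zigzag (`IsPotential.sum_mul_comm`).

By the key formula, `c_P X = 0` if and only if the potential of `X` is constant on `v`-gons, that is
if and only if `X` is the coboundary of a function on the vertices of `G_M`: the kernel of `c_P` is
the bond space of `G_M` (`HasOneZGon.ker_cPhial`).  Interchanging `v` and `f` gives the same for
`c_{P~}` and `G_D`.  Moreover `c_P + c_{P~} = 1`, because `φ (v x) + φ (f x) = X e`.  Hence the two
kernels meet only in zero, and their sum is the kernel of the product (`HasOneZGon.ker_comp`).  The
product is self-adjoint, so its range is the orthogonal complement of this sum, which is the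
intersection of the two cycle spaces.  The dimensions follow, the bond spaces of the connected graphs
`G_M` and `G_D` having dimensions `v - 1` and `f - 1`, and the Euler characteristic is a count of
cells.
-/

namespace CombMap

variable {C E : Type*}

/-! ### Squares and the single `z`-gon -/

lemma z_invol (M : CombMap C E) (x : C) : M.z (M.z x) = x := by
  simp only [z, M.square, M.f_invol, M.v_invol]

lemma z_ne (M : CombMap C E) (x : C) : M.z x ≠ x := M.phial.v_ne x

lemma v_z (M : CombMap C E) (x : C) : M.v (M.z x) = M.f x := M.v_invol _

lemma f_z (M : CombMap C E) (x : C) : M.f (M.z x) = M.v x := by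
  rw [z, M.square, M.f_invol]

lemma z_v (M : CombMap C E) (x : C) : M.z (M.v x) = M.f x := by
  rw [z, ← M.square, M.v_invol]

lemma edge_v (M : CombMap C E) (x : C) : M.edge (M.v x) = M.edge x :=
  ((M.edge_eq x _).2 (by tauto)).symm

lemma edge_f (M : CombMap C E) (x : C) : M.edge (M.f x) = M.edge x :=
  ((M.edge_eq x _).2 (by tauto)).symm

lemma edge_z (M : CombMap C E) (x : C) : M.edge (M.z x) = M.edge x := by
  rw [z, edge_v, edge_f]

lemma eq_of_edge_eq (M : CombMap C E) {x y : C} (h : M.edge y = M.edge x) :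
    y = x ∨ y = M.v x ∨ y = M.f x ∨ y = M.z x :=
  (M.edge_eq x y).1 h.symm

lemma dual_z (M : CombMap C E) : M.dual.z = M.z := by
  funext x
  exact (M.square x).symm

lemma HasOneZGon.dual {M : CombMap C E} (hM : M.HasOneZGon) : M.dual.HasOneZGon := by
  change Nat.card (PolygonSet M.a M.dual.z) = 1
  rw [dual_z]
  exact hM

/-- A property of vertices of `C_M` that is stable under `a` and `z` holds everywhere as soon as it
holds somewhere, if there is a single `z`-gon. -/
lemma HasOneZGon.iff {M : CombMap C E} (hM : M.HasOneZGon) {p : C → Prop}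
    (ha : ∀ x, p (M.a x) ↔ p x) (hz : ∀ x, p (M.z x) ↔ p x) (x y : C) : p x ↔ p y := by
  have hs : Subsingleton M.ZGon := (Nat.card_eq_one_iff_unique.1 hM).1
  have h : (Quot.mk _ x : M.ZGon) = (Quot.mk _ y : M.ZGon) := hs.elim _ _
  have hp : ∀ x y, (y = M.a x ∨ y = M.z x) → p x = p y := by
    rintro x _ (rfl | rfl)
    · exact propext (ha x).symm
    · exact propext (hz x).symm
  exact iff_of_eq (congrArg (Quot.lift p hp) h)

/-! ### Orientations of the zigzag -/

/-- The permutation of the vertices of `C_M` given by one step along the zigzag. -/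
def zigzag (M : CombMap C E) : Equiv.Perm C where
  toFun := M.zigzagStep
  invFun x := M.z (M.a x)
  left_inv x := by simp only [zigzagStep, M.a_invol, M.z_invol]
  right_inv x := by simp only [zigzagStep, M.a_invol, M.z_invol]

lemma zigzagStep_injective (M : CombMap C E) : Function.Injective M.zigzagStep :=
  M.zigzag.injective

/-- An orientation of the zigzag: of the two ends of each `z`-edge and of each `a`-edge, exactly one
is selected.  The selected vertices are those at which a traversal of the zigzag in a fixed
direction enters a square. -/
structure IsOrientation (M : CombMap C E) (P : C → Prop) : Prop where
  z : ∀ x, P (M.z x) ↔ ¬ P x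
  a : ∀ x, P (M.a x) ↔ ¬ P x

lemma IsOrientation.zigzagStep {M : CombMap C E} {P : C → Prop} (hP : M.IsOrientation P) (x : C) :
    P (M.zigzagStep x) ↔ P x := by
  rw [CombMap.zigzagStep, hP.a, hP.z, not_not]

lemma IsOrientation.iterate {M : CombMap C E} {P : C → Prop} (hP : M.IsOrientation P) (n : ℕ)
    (x : C) : P (M.zigzagStep^[n] x) ↔ P x := by
  induction n with
  | zero => rfl
  | succ n ih => rw [Function.iterate_succ_apply', hP.zigzagStep, ih]

lemma IsOrientation.f {M : CombMap C E} {P : C → Prop} (hP : M.IsOrientation P) (x : C) :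
    P (M.f x) ↔ ¬ P (M.v x) := by
  rw [← M.z_v, hP.z]

/-- Walking along the zigzag never leads from one end of a `z`-edge to the other one: halfway,
there would be a fixed point of `z` or of `a`. -/
lemma iterate_zigzagStep_ne (M : CombMap C E) (n : ℕ) (x : C) :
    M.zigzagStep^[n] x ≠ M.z x := by
  induction n using Nat.strong_induction_on generalizing x with
  | _ n ih =>
    match n with
    | 0 => exact (M.z_ne x).symm
    | 1 => exact M.a_ne _
    | n + 2 =>
      intro h
      rw [Function.iterate_succ_apply'] at h
      refine ih n (by omega) (M.zigzagStep x) ?_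
      rw [← Function.iterate_succ_apply]
      have h' := congrArg (fun y => M.z (M.a y)) h
      simp only [zigzagStep, M.a_invol, M.z_invol] at h' ⊢
      exact h'

lemma sameCycle_iff [Finite C] (M : CombMap C E) (x y : C) :
    M.zigzag.SameCycle x y ↔ ∃ n : ℕ, M.zigzagStep^[n] x = y := by
  constructor
  · intro h
    obtain ⟨n, hn⟩ := h.exists_nat_pow_eq
    rw [← Equiv.Perm.iterate_eq_pow] at hn
    exact ⟨n, hn⟩
  · rintro ⟨n, rfl⟩
    refine ⟨n, ?_⟩
    rw [zpow_natCast, ← Equiv.Perm.iterate_eq_pow]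
    rfl

lemma sameCycle_zigzagStep (M : CombMap C E) (x y : C) :
    M.zigzag.SameCycle x (M.zigzagStep y) ↔ M.zigzag.SameCycle x y :=
  Equiv.Perm.sameCycle_apply_right (f := M.zigzag)

lemma sameCycle_z_a (M : CombMap C E) (x y : C) :
    M.zigzag.SameCycle x (M.z (M.a y)) ↔ M.zigzag.SameCycle x y := by
  rw [← sameCycle_zigzagStep, zigzagStep, M.z_invol, M.a_invol]

/-- The orbits of `zigzagStep` are the two orientations of the zigzag. -/
lemma HasOneZGon.isOrientation [Finite C] {M : CombMap C E} (hM : M.HasOneZGon) (x : C) :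
    M.IsOrientation (M.zigzag.SameCycle x) := by
  have hz : ∀ y, M.zigzag.SameCycle x (M.z y) ↔ ¬ M.zigzag.SameCycle x y := by
    intro y
    constructor
    · intro h h'
      obtain ⟨n, hn⟩ := (M.sameCycle_iff _ _).1 (h'.symm.trans h)
      exact M.iterate_zigzagStep_ne n y hn
    · have key := (hM.iff (p := fun y => M.zigzag.SameCycle x y ∨ M.zigzag.SameCycle x (M.z y))
        (fun y => ?_) (fun y => ?_) x y).1 (Or.inl (Equiv.Perm.SameCycle.refl _ _))
      · tauto
      · have h := M.sameCycle_zigzagStep x (M.z y)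
        rw [zigzagStep, M.z_invol] at h
        rw [sameCycle_z_a, h]
        tauto
      · rw [M.z_invol]
        tauto
  refine ⟨hz, fun y => ?_⟩
  have h := hz (M.a y)
  rw [sameCycle_z_a] at h
  tauto

lemma HasOneZGon.exists_isOrientation [Finite C] {M : CombMap C E} (hM : M.HasOneZGon) :
    ∃ P, M.IsOrientation P :=
  M.nonempty.elim fun x => ⟨_, hM.isOrientation x⟩

/-! ### Sums over an orientation -/

lemma IsOrientation.eq_or_eq_of_edge_eq {M : CombMap C E} {P : C → Prop} (hP : M.IsOrientation P)
    {x y : C} (h : M.edge y = M.edge x) (hxy : P y ↔ P x) :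
    y = x ∨ (y = M.v x ∧ (P (M.v x) ↔ P x)) ∨ (y = M.f x ∧ ¬ (P (M.v x) ↔ P x)) := by
  have hz := hP.z x
  have hf := hP.f x
  rcases M.eq_of_edge_eq h with rfl | rfl | rfl | rfl <;> tauto

open scoped Classical in
/-- The selected vertices of an orientation can be summed square by square: beside a selected `x`,
the square of `x` has the selected vertex `v x` or `f x`. -/
lemma IsOrientation.sum_eq [Fintype C] [Fintype E] {M : CombMap C E} {P : C → Prop}
    (hP : M.IsOrientation P) (h : C → ZMod 2) (g : E → ZMod 2)
    (hg : ∀ x, P x → h x + h (if P (M.v x) then M.v x else M.f x) = g (M.edge x)) :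
    ∑ x with P x, h x = ∑ e, g e := by
  rw [← Finset.sum_fiberwise (Finset.univ.filter P) M.edge]
  refine Finset.sum_congr rfl fun e _ => ?_
  obtain ⟨x, rfl, hx⟩ : ∃ x, M.edge x = e ∧ P x := by
    obtain ⟨x, rfl⟩ := M.edge_surj e
    by_cases hx : P x
    · exact ⟨x, rfl, hx⟩
    · exact ⟨M.z x, M.edge_z x, (hP.z x).2 hx⟩
  rw [← hg x hx]
  set x' := if P (M.v x) then M.v x else M.f x with hx'
  have hfil : (Finset.univ.filter P).filter (fun y => M.edge y = M.edge x) = {x, x'} := by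
    ext y
    simp only [Finset.mem_filter, Finset.mem_univ, true_and, Finset.mem_insert,
      Finset.mem_singleton]
    constructor
    · rintro ⟨hy, he⟩
      rcases hP.eq_or_eq_of_edge_eq he (by tauto) with h | h | h
      · exact Or.inl h
      · rw [hx', if_pos (by tauto)]
        exact Or.inr h.1
      · rw [hx', if_neg (by tauto)]
        exact Or.inr h.1
    · rintro (rfl | rfl)
      · exact ⟨hx, rfl⟩
      · by_cases hv : P (M.v x)
        · rw [hx', if_pos hv]
          exact ⟨hv, M.edge_v x⟩
        · rw [hx', if_neg hv, hP.f]
          exact ⟨hv, M.edge_f x⟩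
  have hne : x ≠ x' := by
    rw [hx']
    split_ifs
    · exact (M.v_ne x).symm
    · exact (M.f_ne x).symm
  rw [hfil, Finset.sum_pair hne]

open scoped Classical in
lemma IsOrientation.sum_edge_eq_zero [Fintype C] [Fintype E] {M : CombMap C E} {P : C → Prop}
    (hP : M.IsOrientation P) (X : E → ZMod 2) : ∑ x with P x, X (M.edge x) = 0 := by
  rw [hP.sum_eq _ (fun _ => 0), Finset.sum_const_zero]
  intro x _
  split_ifs
  · rw [M.edge_v, CharTwo.add_self_eq_zero]
  · rw [M.edge_f, CharTwo.add_self_eq_zero]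

open scoped Classical in
lemma IsOrientation.sum_zigzagStep [Fintype C] {M : CombMap C E} {P : C → Prop}
    (hP : M.IsOrientation P) (h : C → ZMod 2) :
    ∑ x with P x, h (M.zigzagStep x) = ∑ x with P x, h x := by
  refine Finset.sum_equiv M.zigzag (fun x => ?_) (fun x _ => rfl)
  simp only [Finset.mem_filter, Finset.mem_univ, true_and]
  exact (hP.zigzagStep x).symm

/-! ### Potentials along the zigzag -/

/-- A potential of `X`: a `GF(2)`-valued function on the vertices of `C_M` which is constant on
`a`-edges and changes along a `z`-edge by the value of `X` at its square. -/
structure IsPotential (M : CombMap C E) (φ : C → ZMod 2) (X : E → ZMod 2) : Prop where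
  a : ∀ x, φ (M.a x) = φ x
  z : ∀ x, φ (M.z x) = φ x + X (M.edge x)

lemma IsPotential.dual {M : CombMap C E} {φ : C → ZMod 2} {X : E → ZMod 2}
    (h : M.IsPotential φ X) : M.dual.IsPotential φ X where
  a := h.a
  z x := by
    rw [dual_z]
    exact h.z x

lemma IsPotential.zigzagStep {M : CombMap C E} {φ : C → ZMod 2} {X : E → ZMod 2}
    (h : M.IsPotential φ X) (x : C) : φ (M.zigzagStep x) = φ x + X (M.edge x) := by
  rw [CombMap.zigzagStep, h.a, h.z]

lemma IsPotential.iterate {M : CombMap C E} {φ : C → ZMod 2} {X : E → ZMod 2}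
    (h : M.IsPotential φ X) (n : ℕ) (x : C) :
    φ (M.zigzagStep^[n] x) = φ x + ∑ k ∈ Finset.range n, X (M.edge (M.zigzagStep^[k] x)) := by
  induction n with
  | zero => simp
  | succ n ih =>
    rw [Function.iterate_succ_apply', h.zigzagStep, ih, Finset.sum_range_succ, add_assoc]

lemma IsPotential.f {M : CombMap C E} {φ : C → ZMod 2} {X : E → ZMod 2}
    (h : M.IsPotential φ X) (x : C) : φ (M.f x) = φ (M.v x) + X (M.edge x) := by
  rw [← M.z_v, h.z, M.edge_v]

/-- The difference of a potential along the `v`-edges depends on the square only. -/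
lemma IsPotential.v_add_eq {M : CombMap C E} {φ : C → ZMod 2} {X : E → ZMod 2}
    (h : M.IsPotential φ X) {x y : C} (hxy : M.edge y = M.edge x) :
    φ (M.v y) + φ y = φ (M.v x) + φ x := by
  rcases M.eq_of_edge_eq hxy with rfl | rfl | rfl | rfl
  · rfl
  · rw [M.v_invol, add_comm]
  · change φ (M.z x) + _ = _
    rw [h.f, h.z]
    linear_combination X (M.edge x) * CharTwo.two_eq_zero (R := ZMod 2)
  · rw [M.v_z, h.f, h.z]
    linear_combination X (M.edge x) * CharTwo.two_eq_zero (R := ZMod 2)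

lemma IsPotential.sum_smul [Fintype E] [DecidableEq E] {M : CombMap C E} {φ : E → C → ZMod 2}
    (hφ : ∀ e, M.IsPotential (φ e) (Pi.single e 1)) (X : E → ZMod 2) :
    M.IsPotential (fun x => ∑ e, X e * φ e x) X where
  a x := by simp only [(hφ _).a]
  z x := by
    simp only [(hφ _).z, mul_add, Finset.sum_add_distrib, Pi.single_apply, mul_ite, mul_one,
      mul_zero, Finset.sum_ite_eq, Finset.mem_univ, if_true]

/-- With a single `z`-gon, two potentials of `X` differ by a constant. -/
lemma IsPotential.add_eq {M : CombMap C E} (hM : M.HasOneZGon) {φ ψ : C → ZMod 2}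
    {X : E → ZMod 2} (hφ : M.IsPotential φ X) (hψ : M.IsPotential ψ X) (x y : C) :
    φ x + ψ x = φ y + ψ y := by
  refine ((hM.iff (p := fun w => φ w + ψ w = φ y + ψ y) (fun w => ?_) (fun w => ?_) x y).2 rfl)
  · rw [hφ.a, hψ.a]
  · rw [hφ.z, hψ.z, show φ w + X (M.edge w) + (ψ w + X (M.edge w)) = φ w + ψ w by
      linear_combination X (M.edge w) * CharTwo.two_eq_zero (R := ZMod 2)]

open scoped Classical in
/-- With a single `z`-gon, every `X` has a potential: sum `X` along the zigzag.  The sum over the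
whole zigzag vanishes, as every square is traversed twice. -/
lemma HasOneZGon.exists_isPotential [Fintype C] [Fintype E] {M : CombMap C E}
    (hM : M.HasOneZGon) (X : E → ZMod 2) : ∃ φ, M.IsPotential φ X := by
  obtain ⟨x⟩ := M.nonempty
  set P := M.zigzag.SameCycle x with hPdef
  have hP : M.IsOrientation P := hM.isOrientation x
  have hex : ∀ y, P y ↔ ∃ n, M.zigzagStep^[n] x = y := M.sameCycle_iff x
  set m := Function.minimalPeriod M.zigzagStep x with hm
  have hper : x ∈ Function.periodicPts M.zigzagStep :=
    M.zigzagStep_injective.mem_periodicPts x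
  have hmpos : 0 < m := Function.minimalPeriod_pos_of_mem_periodicPts hper
  set S : ℕ → ZMod 2 := fun n => ∑ k ∈ Finset.range n, X (M.edge (M.zigzagStep^[k] x)) with hS
  have hSm : S m = 0 := by
    rw [← hP.sum_edge_eq_zero X]
    refine Finset.sum_nbij (fun k => M.zigzagStep^[k] x) ?_ ?_ ?_ ?_
    · intro k _
      simpa using (hex _).2 ⟨k, rfl⟩
    · intro i hi j hj hij
      exact (Function.iterate_eq_iterate_iff_of_lt_minimalPeriod (by simpa using hi)
        (by simpa using hj)).1 hij
    · intro y hy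
      obtain ⟨n, rfl⟩ := (hex y).1 (by simpa using hy)
      refine ⟨n % m, by simpa using Nat.mod_lt _ hmpos, Function.iterate_mod_minimalPeriod_eq⟩
    · intro k _
      rfl
  have hSper : Function.Periodic S m := by
    intro n
    have h : ∀ k, M.zigzagStep^[m + k] x = M.zigzagStep^[k] x := by
      intro k
      rw [add_comm, Function.iterate_add_apply, Function.iterate_minimalPeriod]
    simp only [hS, add_comm n m, Finset.sum_range_add, h]
    exact (congrArg (· + _) hSm).trans (zero_add _)
  have hSeq : ∀ i j, M.zigzagStep^[i] x = M.zigzagStep^[j] x → S i = S j := by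
    intro i j hij
    rw [← hSper.map_mod_nat i, ← hSper.map_mod_nat j]
    congr 1
    refine (Function.iterate_eq_iterate_iff_of_lt_minimalPeriod (Nat.mod_lt _ hmpos)
      (Nat.mod_lt _ hmpos)).1 ?_
    rw [Function.iterate_mod_minimalPeriod_eq, Function.iterate_mod_minimalPeriod_eq, hij]
  set ψ : C → ZMod 2 := fun y => if h : ∃ n, M.zigzagStep^[n] x = y then S h.choose else 0
    with hψ
  have hψS : ∀ n, ψ (M.zigzagStep^[n] x) = S n := by
    intro n
    have h : ∃ k, M.zigzagStep^[k] x = M.zigzagStep^[n] x := ⟨n, rfl⟩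
    simp only [hψ]
    rw [dif_pos h]
    exact hSeq _ _ h.choose_spec
  have hψstep : ∀ y, P y → ψ (M.zigzagStep y) = ψ y + X (M.edge y) := by
    intro y hy
    obtain ⟨n, rfl⟩ := (hex y).1 hy
    rw [← Function.iterate_succ_apply' M.zigzagStep, hψS, hψS]
    exact Finset.sum_range_succ _ _
  -- At the vertices of the opposite orientation, the rule for `z`-edges forces the values.
  set φ : C → ZMod 2 := fun y => if P y then ψ y else ψ (M.z y) + X (M.edge y) with hφ
  have hφ₁ : ∀ y, P y → φ y = ψ y := fun y hy => if_pos hy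
  have hφ₂ : ∀ y, ¬ P y → φ y = ψ (M.z y) + X (M.edge y) := fun y hy => if_neg hy
  have ha : ∀ y, ¬ P y → φ (M.a y) = φ y := by
    intro y hy
    have h := hψstep (M.z y) ((hP.z y).2 hy)
    rw [zigzagStep, M.z_invol, M.edge_z] at h
    rw [hφ₁ _ ((hP.a y).2 hy), hφ₂ y hy, h]
  refine ⟨φ, fun y => ?_, fun y => ?_⟩
  · by_cases hy : P y
    · have h := ha (M.a y) (fun h => (hP.a y).1 h hy)
      rw [M.a_invol] at h
      exact h.symm
    · exact ha y hy
  · by_cases hy : P y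
    · rw [hφ₁ y hy, hφ₂ _ (fun h => (hP.z y).1 h hy), M.z_invol, M.edge_z]
    · rw [hφ₂ y hy, hφ₁ _ ((hP.z y).2 hy), add_assoc, CharTwo.add_self_eq_zero, add_zero]

/-! ### The matrix of `c_P` -/

/-- The map `X ↦ (φ (v x) + φ x)`, where `φ` is a potential of `X`, is self-adjoint.  This is
summation by parts along the zigzag, where the boundary terms cancel because the zigzag is closed
and the products `X * Y` cancel because every square is traversed twice. -/
lemma IsPotential.sum_mul_comm [Finite C] [Fintype E] {M : CombMap C E} (hM : M.HasOneZGon)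
    {φ ψ : C → ZMod 2} {X Y X' Y' : E → ZMod 2} (hφ : M.IsPotential φ X) (hψ : M.IsPotential ψ Y)
    (hX' : ∀ x, X' (M.edge x) = φ (M.v x) + φ x) (hY' : ∀ x, Y' (M.edge x) = ψ (M.v x) + ψ x) :
    ∑ e, Y e * X' e = ∑ e, X e * Y' e := by
  classical
  have := Fintype.ofFinite C
  obtain ⟨P, hP⟩ := hM.exists_isOrientation
  -- `t` is the indicator of the squares whose two traversals have opposite directions in `G_M`.
  obtain ⟨t, ht⟩ : ∃ t : E → ZMod 2, ∀ x, P x → t (M.edge x) = if P (M.v x) then 0 else 1 := by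
    refine ⟨fun e => if ∃ x, M.edge x = e ∧ P x ∧ P (M.v x) then 0 else 1, fun x hx => ?_⟩
    refine if_congr ⟨?_, fun h => ⟨x, rfl, hx, h⟩⟩ rfl rfl
    rintro ⟨y, hy, hPy, hPv⟩
    rcases hP.eq_or_eq_of_edge_eq hy (by tauto) with rfl | ⟨rfl, h⟩ | ⟨rfl, -⟩
    · exact hPv
    · exact hPy
    · exact absurd hx ((hP.z x).1 hPv)
  have parts : ∀ {φ : C → ZMod 2} {X X' Y : E → ZMod 2}, M.IsPotential φ X →
      (∀ x, X' (M.edge x) = φ (M.v x) + φ x) →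
      ∑ x with P x, Y (M.edge x) * φ x = ∑ e, Y e * X' e + ∑ e, t e * X e * Y e := by
    intro φ X X' Y hφ hX'
    rw [← Finset.sum_add_distrib]
    refine hP.sum_eq _ _ fun x hx => ?_
    rw [hX', ht x hx]
    split_ifs
    · rw [M.edge_v]
      ring
    · rw [M.edge_f, hφ.f]
      ring
  have h₁ := hP.sum_zigzagStep (fun x => φ x * ψ x)
  simp only [hφ.zigzagStep, hψ.zigzagStep, mul_add, add_mul, Finset.sum_add_distrib] at h₁
  have h₂ := hP.sum_edge_eq_zero (fun e => X e * Y e)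
  have h₃ := parts (Y := Y) hφ hX'
  have h₄ := parts (Y := X) hψ hY'
  have h₅ : ∑ x with P x, φ x * Y (M.edge x) = ∑ x with P x, Y (M.edge x) * φ x :=
    Finset.sum_congr rfl fun _ _ => mul_comm _ _
  have h₆ : ∑ e, t e * Y e * X e = ∑ e, t e * X e * Y e :=
    Finset.sum_congr rfl fun _ _ => mul_right_comm _ _ _
  rw [h₅, h₂, h₃, h₄, h₆] at h₁
  linear_combination h₁ - (∑ e, t e * X e * Y e + ∑ e, X e * Y' e) *
    CharTwo.two_eq_zero (R := ZMod 2)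

lemma IsReturn.iterate_ne {M : CombMap C E} {x : C} {n i j : ℕ} (h : M.IsReturn x n) (hij : i < j)
    (hj : j < n) : M.zigzagStep^[i] x ≠ M.zigzagStep^[j] x := by
  intro heq
  obtain ⟨d, rfl⟩ := Nat.exists_eq_add_of_lt hij
  rw [add_assoc, Function.iterate_add_apply] at heq
  have h' := M.zigzagStep_injective.iterate i heq
  exact h.2.2 (d + 1) (by omega) (by omega) (congrArg M.edge h'.symm)

lemma exists_isReturn [Finite C] (M : CombMap C E) (x : C) :
    ∃ n, M.IsReturn x n := by
  classical
  obtain ⟨m, hm, hx⟩ := M.zigzagStep_injective.mem_periodicPts x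
  have hex : ∃ n, 0 < n ∧ M.edge (M.zigzagStep^[n] x) = M.edge x := ⟨m, hm, congrArg M.edge hx⟩
  exact ⟨Nat.find hex, (Nat.find_spec hex).1, (Nat.find_spec hex).2,
    fun k hk hlt h => Nat.find_min hex hlt ⟨hk, h⟩⟩

/-- When the zigzag enters a square again, it does so at another vertex. -/
lemma HasOneZGon.iterate_ne_self [Finite C] {M : CombMap C E} (hM : M.HasOneZGon) {x : C} {n : ℕ}
    (h : M.IsReturn x n) : M.zigzagStep^[n] x ≠ x := by
  intro hx
  obtain ⟨y, hyx, hne, k, hk⟩ : ∃ y, M.edge y = M.edge x ∧ y ≠ x ∧ ∃ k, M.zigzagStep^[k] x = y := by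
    have hP := hM.isOrientation x
    by_cases hv : M.zigzag.SameCycle x (M.v x)
    · exact ⟨_, M.edge_v x, M.v_ne x, (M.sameCycle_iff _ _).1 hv⟩
    · exact ⟨_, M.edge_f x, M.f_ne x, (M.sameCycle_iff _ _).1 ((hP.f x).2 hv)⟩
  have hper : Function.IsPeriodicPt M.zigzagStep n x := hx
  rw [← hper.iterate_mod_apply] at hk
  rcases Nat.eq_zero_or_pos (k % n) with h0 | h0
  · rw [h0] at hk
    exact hne hk.symm
  · exact h.2.2 _ h0 (Nat.mod_lt _ h.1) (hk ▸ hyx)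

lemma HasOneZGon.iterate_eq [Finite C] {M : CombMap C E} (hM : M.HasOneZGon) {P : C → Prop}
    (hP : M.IsOrientation P) {x : C} {n : ℕ} (h : M.IsReturn x n) :
    (M.zigzagStep^[n] x = M.v x ∧ (P (M.v x) ↔ P x)) ∨
      (M.zigzagStep^[n] x = M.f x ∧ ¬ (P (M.v x) ↔ P x)) :=
  (hP.eq_or_eq_of_edge_eq h.2.1 (hP.iterate n x)).resolve_left (hM.iterate_ne_self h)

open scoped Classical in
/-- The zigzag traverses every square at most twice before it closes up, hence an odd number of
times only if it does so exactly once. -/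
lemma IsReturn.existsUnique_iff {M : CombMap C E} {P : C → Prop} (hP : M.IsOrientation P) {x : C}
    {n : ℕ} (h : M.IsReturn x n) (e : E) :
    (if ∃! k, 0 < k ∧ k < n ∧ M.edge (M.zigzagStep^[k] x) = e then (1 : ZMod 2) else 0) =
      ((Finset.Ioo 0 n).filter fun k => M.edge (M.zigzagStep^[k] x) = e).card := by
  set s := (Finset.Ioo 0 n).filter fun k => M.edge (M.zigzagStep^[k] x) = e with hs
  have hmem : ∀ k, k ∈ s ↔ 0 < k ∧ k < n ∧ M.edge (M.zigzagStep^[k] x) = e := by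
    intro k
    simp only [hs, Finset.mem_filter, Finset.mem_Ioo, and_assoc]
  have hne : ∀ i ∈ s, ∀ j ∈ s, i ≠ j → M.zigzagStep^[i] x ≠ M.zigzagStep^[j] x := by
    intro i hi j hj hij
    rcases lt_or_gt_of_ne hij with hlt | hlt
    · exact h.iterate_ne hlt ((hmem j).1 hj).2.1
    · exact (h.iterate_ne hlt ((hmem i).1 hi).2.1).symm
  have hle : s.card ≤ 2 := by
    by_contra hlt
    obtain ⟨i, hi, j, hj, k, hk, hij, hik, hjk⟩ := Finset.two_lt_card.1 (not_le.1 hlt)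
    have key : ∀ l ∈ s, i ≠ l →
        (M.zigzagStep^[l] x = M.v (M.zigzagStep^[i] x) ∧
          (P (M.v (M.zigzagStep^[i] x)) ↔ P (M.zigzagStep^[i] x))) ∨
        (M.zigzagStep^[l] x = M.f (M.zigzagStep^[i] x) ∧
          ¬ (P (M.v (M.zigzagStep^[i] x)) ↔ P (M.zigzagStep^[i] x))) := by
      intro l hl hil
      refine (hP.eq_or_eq_of_edge_eq ?_ ?_).resolve_left (hne i hi l hl hil).symm
      · rw [((hmem l).1 hl).2.2, ((hmem i).1 hi).2.2]
      · rw [hP.iterate, hP.iterate]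
    apply hne j hj k hk hjk
    rcases key j hj hij with ⟨h₁, h₂⟩ | ⟨h₁, h₂⟩ <;> rcases key k hk hik with ⟨h₃, h₄⟩ | ⟨h₃, h₄⟩
    · rw [h₁, h₃]
    · exact absurd h₂ h₄
    · exact absurd h₄ h₂
    · rw [h₁, h₃]
  have hone : (∃! k, 0 < k ∧ k < n ∧ M.edge (M.zigzagStep^[k] x) = e) ↔ s.card = 1 := by
    simp only [Finset.card_eq_one, Finset.singleton_iff_unique_mem, hmem]
  rw [if_congr hone rfl rfl]
  interval_cases s.card <;> norm_num
  rfl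

/-- The parity of the number of traversals of a square between the two traversals of another one, in
terms of potentials. -/
lemma IsReturn.card_eq [DecidableEq E] {M : CombMap C E} {x : C} {n : ℕ} (h : M.IsReturn x n)
    {e : E} {φ : C → ZMod 2} (hφ : M.IsPotential φ (Pi.single e 1)) :
    (((Finset.Ioo 0 n).filter fun k => M.edge (M.zigzagStep^[k] x) = e).card : ZMod 2) =
      φ (M.zigzagStep^[n] x) + φ x + if M.edge x = e then 1 else 0 := by
  have h₀ : Finset.range n = insert 0 (Finset.Ioo 0 n) := by
    ext k
    have := h.1
    simp only [Finset.mem_range, Finset.mem_insert, Finset.mem_Ioo]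
    omega
  rw [hφ.iterate, h₀, Finset.sum_insert (by simp), Finset.card_filter]
  push_cast
  simp only [Pi.single_apply, Function.iterate_zero, id]
  linear_combination -(φ x + if M.edge x = e then 1 else 0) * CharTwo.two_eq_zero (R := ZMod 2)

open scoped Classical in
/-- The entries of the matrix of `c_P` in terms of potentials.  If the zigzag returns to `f x`
instead of `v x`, then `κ_P` makes up for the difference. -/
lemma HasOneZGon.edgeVec_add_edgeVec [Finite C] {M : CombMap C E} (hM : M.HasOneZGon) {e : E}
    {φ : C → ZMod 2} (hφ : M.IsPotential φ (Pi.single e 1)) (x : C) :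
    edgeVec (M.kappaPhial (M.edge x)) e + edgeVec (M.iPhial (M.edge x)) e = φ (M.v x) + φ x := by
  obtain ⟨P, hP⟩ := hM.exists_isOrientation
  -- All choices of the starting vertex in a square give the same result.
  have hv : ∀ y, M.edge y = M.edge x → ((P (M.v y) ↔ P y) ↔ (P (M.v x) ↔ P x)) := by
    intro y hy
    have hz := hP.z x
    have hf := hP.f x
    rcases M.eq_of_edge_eq hy with rfl | rfl | rfl | rfl
    · rfl
    · rw [M.v_invol]
      tauto
    · change (P (M.z x) ↔ _) ↔ _
      tauto
    · rw [M.v_z]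
      tauto
  have hκ : e ∈ M.kappaPhial (M.edge x) ↔ e = M.edge x ∧ (P (M.v x) ↔ P x) := by
    refine and_congr_right fun _ => ⟨?_, fun h => ?_⟩
    · rintro ⟨y, n, hy, hn, hret⟩
      rw [← hv y hy]
      rcases hret with hret | hret
      · exact absurd hret (hM.iterate_ne_self hn)
      · rw [← hret, hP.iterate]
    · obtain ⟨n, hn⟩ := M.exists_isReturn x
      refine ⟨x, n, rfl, hn, Or.inr ?_⟩
      rcases hM.iterate_eq hP hn with h' | h'
      · exact h'.1
      · exact absurd h h'.2
  have hcount : ∀ y n, M.edge y = M.edge x → M.IsReturn y n →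
      (if ∃! k, 0 < k ∧ k < n ∧ M.edge (M.zigzagStep^[k] y) = e then (1 : ZMod 2) else 0) =
        φ (M.v x) + φ x + if e = M.edge x ∧ (P (M.v x) ↔ P x) then 1 else 0 := by
    intro y n hy hn
    rw [hn.existsUnique_iff hP, hn.card_eq hφ, ← hφ.v_add_eq hy, hy, eq_comm (a := e)]
    have hvy := hv y hy
    rcases hM.iterate_eq hP hn with ⟨h₁, h₂⟩ | ⟨h₁, h₂⟩
    · rw [h₁]
      simp only [hvy.1 h₂, and_true]
    · rw [h₁, hφ.f, hy, Pi.single_apply]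
      simp only [mt hvy.2 h₂, and_false, if_false]
      linear_combination (if M.edge x = e then 1 else 0) * CharTwo.two_eq_zero (R := ZMod 2)
  have hi : edgeVec (M.iPhial (M.edge x)) e =
      φ (M.v x) + φ x + if e = M.edge x ∧ (P (M.v x) ↔ P x) then 1 else 0 := by
    obtain ⟨n, hn⟩ := M.exists_isReturn x
    rw [← hcount x n rfl hn]
    refine if_congr ⟨?_, fun h => ⟨x, n, rfl, hn, h⟩⟩ rfl rfl
    rintro ⟨y, m, hy, hm, h⟩
    have h' := hcount y m hy hm
    rw [if_pos h, ← hcount x n rfl hn] at h'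
    by_contra hcon
    rw [if_neg hcon] at h'
    exact one_ne_zero h'
  rw [hi, edgeVec, if_congr hκ rfl rfl]
  linear_combination (if e = M.edge x ∧ (P (M.v x) ↔ P x) then 1 else 0) *
    CharTwo.two_eq_zero (R := ZMod 2)

/-- The map `c_P` in terms of potentials: the value of `c_P X` at a square is the difference of a
potential of `X` along the `v`-edges of the square. -/
lemma HasOneZGon.cPhial_apply [Finite C] [Fintype E] {M : CombMap C E} (hM : M.HasOneZGon)
    {X : E → ZMod 2} {φ : C → ZMod 2} (hφ : M.IsPotential φ X) (x : C) :
    M.cPhial X (M.edge x) = φ (M.v x) + φ x := by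
  classical
  have := Fintype.ofFinite C
  choose ψ hψ using fun e : E => hM.exists_isPotential (Pi.single e 1)
  set c : E → E → ZMod 2 := fun e => edgeVec (M.kappaPhial e) + edgeVec (M.iPhial e) with hc
  have hψc : ∀ e x, c (M.edge x) e = ψ e (M.v x) + ψ e x := fun e =>
    hM.edgeVec_add_edgeVec (hψ e)
  have hsymm : ∀ e e', c e e' = c e' e := by
    intro e e'
    have h := IsPotential.sum_mul_comm hM (X' := fun e => c e e') (Y' := fun e' => c e' e)
      (hψ e') (hψ e) (hψc e') (hψc e)
    simpa [Pi.single_apply] using h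
  have hsum := IsPotential.sum_smul hψ X
  have h := IsPotential.add_eq hM hφ hsum (M.v x) x
  have hX : M.cPhial X (M.edge x) = ∑ e, X e * c e (M.edge x) := by
    rw [cPhial, Fintype.linearCombination_apply, Finset.sum_apply]
    rfl
  simp only [hX, hsymm _ (M.edge x), hψc, mul_add, Finset.sum_add_distrib]
  linear_combination -h + (∑ e, X e * ψ e (M.v x) - φ x) * CharTwo.two_eq_zero (R := ZMod 2)

lemma HasOneZGon.sum_mul_cPhial [Finite C] [Fintype E] {M : CombMap C E} (hM : M.HasOneZGon)
    (X Y : E → ZMod 2) : ∑ e, Y e * M.cPhial X e = ∑ e, X e * M.cPhial Y e := by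
  have := Fintype.ofFinite C
  obtain ⟨φ, hφ⟩ := hM.exists_isPotential X
  obtain ⟨ψ, hψ⟩ := hM.exists_isPotential Y
  exact hφ.sum_mul_comm hM hψ (hM.cPhial_apply hφ) (hM.cPhial_apply hψ)

/-- A square is traversed in the same direction in exactly one of `G_M` and `G_D`, so that `c_P` and
`c_{P~}` add up to the identity. -/
lemma HasOneZGon.cPhial_add_dual_cPhial [Finite C] [Fintype E] {M : CombMap C E}
    (hM : M.HasOneZGon) (X : E → ZMod 2) : M.cPhial X + M.dual.cPhial X = X := by
  have := Fintype.ofFinite C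
  obtain ⟨φ, hφ⟩ := hM.exists_isPotential X
  funext e
  obtain ⟨x, rfl⟩ := M.edge_surj e
  have h : M.dual.cPhial X (M.edge x) = φ (M.f x) + φ x := hM.dual.cPhial_apply hφ.dual x
  rw [Pi.add_apply, hM.cPhial_apply hφ, h, hφ.f]
  linear_combination (φ (M.v x) + φ x) * CharTwo.two_eq_zero (R := ZMod 2)

/-! ### Bonds and cycles of the induced graph -/

instance [Finite C] (s t : C → C) : Finite (PolygonSet s t) :=
  inferInstanceAs (Finite (Quot _))

instance [Finite C] (M : CombMap C E) : Finite M.VGon :=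
  inferInstanceAs (Finite (PolygonSet _ _))

instance [Finite C] (M : CombMap C E) : Finite M.FGon :=
  inferInstanceAs (Finite (PolygonSet _ _))

instance [Finite C] (s : C → C) : Finite (MatchingEdges s) :=
  inferInstanceAs (Finite (Quot _))

lemma vgon_a (M : CombMap C E) (x : C) : M.vgon (M.a x) = M.vgon x :=
  (Quot.sound (r := fun x y => y = M.a x ∨ y = M.v x) (Or.inl rfl)).symm

lemma vgon_z (M : CombMap C E) (x : C) : M.vgon (M.z x) = M.vgon (M.f x) :=
  M.vgon_v _

lemma isLink_inducedGraph_iff (M : CombMap C E) (x : C) (p q : M.VGon) :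
    M.inducedGraph.IsLink (M.edge x) p q ↔
      (M.vgon x = p ∧ M.vgon (M.f x) = q) ∨ (M.vgon (M.f x) = p ∧ M.vgon x = q) := by
  constructor
  · rintro ⟨y, hy, rfl, rfl⟩
    rcases M.eq_of_edge_eq hy with rfl | rfl | rfl | rfl
    · exact Or.inl ⟨rfl, rfl⟩
    · exact Or.inl ⟨(M.vgon_v x).symm, by rw [← M.square, M.vgon_v]⟩
    · exact Or.inr ⟨rfl, by rw [M.f_invol]⟩
    · exact Or.inr ⟨(M.vgon_z x).symm, by rw [M.f_z, M.vgon_v]⟩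
  · rintro (⟨rfl, rfl⟩ | ⟨rfl, rfl⟩)
    · exact ⟨x, rfl, rfl, rfl⟩
    · exact ⟨M.f x, M.edge_f x, rfl, by rw [M.f_invol]⟩

/-- The coboundary map of `G_M` over `GF(2)`: the value at an edge is the sum of the values at its
two ends. -/
noncomputable def coboundary (M : CombMap C E) :
    (M.VGon → ZMod 2) →ₗ[ZMod 2] (E → ZMod 2) where
  toFun ψ e := ψ (M.vgon (Function.surjInv M.edge_surj e)) +
    ψ (M.vgon (M.f (Function.surjInv M.edge_surj e)))
  map_add' ψ χ := by
    funext e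
    simp only [Pi.add_apply]
    ring
  map_smul' r ψ := by
    funext e
    simp only [Pi.smul_apply, smul_eq_mul, RingHom.id_apply]
    ring

lemma coboundary_apply (M : CombMap C E) (ψ : M.VGon → ZMod 2) (x : C) :
    M.coboundary ψ (M.edge x) = ψ (M.vgon x) + ψ (M.vgon (M.f x)) := by
  set y := Function.surjInv M.edge_surj (M.edge x) with hy
  have hyx : M.edge y = M.edge x := Function.surjInv_eq M.edge_surj _
  have h : M.inducedGraph.IsLink (M.edge x) (M.vgon y) (M.vgon (M.f y)) := ⟨y, hyx, rfl, rfl⟩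
  change ψ (M.vgon y) + ψ (M.vgon (M.f y)) = _
  rcases (M.isLink_inducedGraph_iff x _ _).1 h with ⟨h₁, h₂⟩ | ⟨h₁, h₂⟩
  · rw [h₁, h₂]
  · rw [h₁, h₂, add_comm]

open scoped Classical in
lemma edgeVec_graphBond (M : CombMap C E) (W : Set M.VGon) :
    edgeVec (graphBond M.inducedGraph W) = M.coboundary (fun p => if p ∈ W then 1 else 0) := by
  funext e
  obtain ⟨x, rfl⟩ := M.edge_surj e
  have h : M.edge x ∈ graphBond M.inducedGraph W ↔
      (M.vgon x ∈ W ∧ M.vgon (M.f x) ∉ W) ∨ (M.vgon (M.f x) ∈ W ∧ M.vgon x ∉ W) := by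
    constructor
    · rintro ⟨p, hp, q, hq, hpq⟩
      rcases (M.isLink_inducedGraph_iff x _ _).1 hpq with ⟨rfl, rfl⟩ | ⟨rfl, rfl⟩
      · exact Or.inl ⟨hp, hq.2⟩
      · exact Or.inr ⟨hp, hq.2⟩
    · rintro (⟨hp, hq⟩ | ⟨hp, hq⟩)
      · exact ⟨_, hp, _, ⟨Set.mem_univ _, hq⟩,
          (M.isLink_inducedGraph_iff x _ _).2 (Or.inl ⟨rfl, rfl⟩)⟩
      · exact ⟨_, hp, _, ⟨Set.mem_univ _, hq⟩,
          (M.isLink_inducedGraph_iff x _ _).2 (Or.inr ⟨rfl, rfl⟩)⟩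
  rw [coboundary_apply, edgeVec, if_congr h rfl rfl]
  by_cases h₁ : M.vgon x ∈ W <;> by_cases h₂ : M.vgon (M.f x) ∈ W <;>
    simp [h₁, h₂, CharTwo.add_self_eq_zero]

lemma bondSpace_inducedGraph (M : CombMap C E) :
    bondSpace M.inducedGraph = LinearMap.range M.coboundary := by
  classical
  apply le_antisymm
  · refine Submodule.span_le.2 ?_
    rintro _ ⟨W, -, rfl⟩
    exact ⟨_, (M.edgeVec_graphBond W).symm⟩
  · rintro _ ⟨ψ, rfl⟩
    refine Submodule.subset_span ⟨{p | ψ p = 1}, Set.subset_univ _, ?_⟩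
    rw [edgeVec_graphBond]
    congr 1
    funext p
    have h : ∀ a : ZMod 2, a ≠ 1 → a = 0 := by decide
    split_ifs with hp
    · exact hp
    · exact h _ hp

lemma mem_cycleSpace_inducedGraph [Finite C] [Fintype E] (M : CombMap C E) (X : E → ZMod 2) :
    X ∈ cycleSpace M.inducedGraph ↔ ∀ Y ∈ bondSpace M.inducedGraph, ∑ e, X e * Y e = 0 := by
  classical
  have hstar : ∀ p, ∑ e with M.inducedGraph.IsNonloopAt e p, X e =
      ∑ e, X e * M.coboundary (Pi.single p 1) e := by
    intro p
    rw [Finset.sum_filter]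
    refine Finset.sum_congr rfl fun e _ => ?_
    obtain ⟨x, rfl⟩ := M.edge_surj e
    have h : M.inducedGraph.IsNonloopAt (M.edge x) p ↔
        (M.vgon x = p ∧ M.vgon (M.f x) ≠ p) ∨ (M.vgon (M.f x) = p ∧ M.vgon x ≠ p) := by
      simp only [Graph.IsNonloopAt, isLink_inducedGraph_iff]
      constructor
      · rintro ⟨q, hq, ⟨h₁, rfl⟩ | ⟨h₁, rfl⟩⟩
        · exact Or.inl ⟨h₁, hq⟩
        · exact Or.inr ⟨h₁, hq⟩
      · rintro (⟨h₁, h₂⟩ | ⟨h₁, h₂⟩)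
        · exact ⟨_, h₂, Or.inl ⟨h₁, rfl⟩⟩
        · exact ⟨_, h₂, Or.inr ⟨h₁, rfl⟩⟩
    rw [if_congr h rfl rfl, coboundary_apply, Pi.single_apply, Pi.single_apply]
    by_cases h₁ : M.vgon x = p <;> by_cases h₂ : M.vgon (M.f x) = p <;>
      simp [h₁, h₂, CharTwo.add_self_eq_zero]
  rw [bondSpace_inducedGraph]
  constructor
  · rintro hX _ ⟨ψ, rfl⟩
    have h : ((∑ e, X e • LinearMap.proj e : (E → ZMod 2) →ₗ[ZMod 2] ZMod 2) ∘ₗ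
        M.coboundary) = 0 := by
      refine LinearMap.pi_ext' fun p => LinearMap.ext_ring ?_
      simpa [LinearMap.sum_apply] using (hstar p).symm.trans (hX p (Set.mem_univ p))
    simpa [LinearMap.sum_apply] using LinearMap.congr_fun h ψ
  · intro h p _
    rw [hstar]
    exact h _ ⟨_, rfl⟩

/-- As `G_M` is connected, its bond space has dimension `v - 1`. -/
lemma finrank_bondSpace_inducedGraph [Finite C] [Finite E] (M : CombMap C E) :
    Module.finrank (ZMod 2) (bondSpace M.inducedGraph) + 1 = Nat.card M.VGon := by
  have := Fintype.ofFinite M.VGon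
  obtain ⟨x₀⟩ := M.nonempty
  have hker : LinearMap.ker M.coboundary = Submodule.span (ZMod 2) {fun _ => (1 : ZMod 2)} := by
    apply le_antisymm
    · intro ψ hψ
      have hf : ∀ x, ψ (M.vgon (M.f x)) = ψ (M.vgon x) := by
        intro x
        have h : M.coboundary ψ (M.edge x) = 0 := by rw [LinearMap.mem_ker.1 hψ, Pi.zero_apply]
        rw [coboundary_apply, CharTwo.add_eq_zero] at h
        exact h.symm
      have hconst : ∀ x y, Relation.EqvGen (fun x y => y = M.v x ∨ y = M.f x ∨ y = M.a x) x y →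
          ψ (M.vgon x) = ψ (M.vgon y) := by
        intro x y h
        induction h with
        | rel x y h =>
          rcases h with rfl | rfl | rfl
          · rw [vgon_v]
          · rw [hf]
          · rw [vgon_a]
        | refl x => rfl
        | symm x y _ ih => exact ih.symm
        | trans x y w _ _ ih₁ ih₂ => exact ih₁.trans ih₂
      refine Submodule.mem_span_singleton.2 ⟨ψ (M.vgon x₀), ?_⟩
      funext p
      induction p using Quot.ind with
      | _ y =>
        exact (mul_one _).trans (hconst x₀ y (M.connected x₀ y))
    · rw [Submodule.span_singleton_le_iff_mem, LinearMap.mem_ker]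
      funext e
      obtain ⟨x, rfl⟩ := M.edge_surj e
      rw [coboundary_apply, CharTwo.add_self_eq_zero, Pi.zero_apply]
  have hne : (fun _ : M.VGon => (1 : ZMod 2)) ≠ 0 := fun h =>
    one_ne_zero (congrFun h (M.vgon x₀))
  have h := LinearMap.finrank_range_add_finrank_ker M.coboundary
  rw [hker, finrank_span_singleton hne, Module.finrank_fintype_fun_eq_card,
    ← Nat.card_eq_fintype_card, ← bondSpace_inducedGraph] at h
  exact h

/-- The kernel of `c_P` is the bond space: `c_P X = 0` says that a potential of `X` is constant on
the `v`-gons, hence that `X` is its coboundary. -/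
lemma HasOneZGon.ker_cPhial [Finite C] [Fintype E] {M : CombMap C E} (hM : M.HasOneZGon) :
    LinearMap.ker M.cPhial = bondSpace M.inducedGraph := by
  have := Fintype.ofFinite C
  rw [bondSpace_inducedGraph]
  apply le_antisymm
  · intro X hX
    obtain ⟨φ, hφ⟩ := hM.exists_isPotential X
    have hv : ∀ x, φ (M.v x) = φ x := by
      intro x
      rw [← CharTwo.add_eq_zero, ← hM.cPhial_apply hφ, LinearMap.mem_ker.1 hX, Pi.zero_apply]
    have hlift : ∀ x y, (y = M.a x ∨ y = M.v x) → φ x = φ y := by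
      rintro x _ (rfl | rfl)
      · rw [hφ.a]
      · rw [hv]
    obtain ⟨ψ, hψ⟩ : ∃ ψ : M.VGon → ZMod 2, ∀ x, ψ (M.vgon x) = φ x :=
      ⟨Quot.lift φ hlift, fun _ => rfl⟩
    refine ⟨ψ, ?_⟩
    funext e
    obtain ⟨x, rfl⟩ := M.edge_surj e
    rw [coboundary_apply, hψ, hψ, hφ.f, hv, ← add_assoc, CharTwo.add_self_eq_zero, zero_add]
  · rintro _ ⟨ψ, rfl⟩
    have hφ : M.IsPotential (fun x => ψ (M.vgon x)) (M.coboundary ψ) := by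
      refine ⟨fun x => by rw [vgon_a], fun x => ?_⟩
      rw [vgon_z, coboundary_apply, ← add_assoc, CharTwo.add_self_eq_zero, zero_add]
    rw [LinearMap.mem_ker]
    funext e
    obtain ⟨x, rfl⟩ := M.edge_surj e
    rw [hM.cPhial_apply hφ, vgon_v, CharTwo.add_self_eq_zero, Pi.zero_apply]

/-! ### The Euler characteristic -/

lemma card_eq_mul_of_card_fiber {A B : Type*} [Fintype A] [DecidableEq B] [Finite B] (g : A → B)
    (hg : Function.Surjective g) (n : ℕ)
    (h : ∀ x, (Finset.univ.filter fun y => g y = g x).card = n) :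
    Nat.card A = n * Nat.card B := by
  have := Fintype.ofFinite B
  rw [Nat.card_eq_fintype_card, Nat.card_eq_fintype_card, ← Finset.card_univ, ← Finset.card_univ]
  rw [Finset.card_eq_sum_card_fiberwise (f := g) (t := Finset.univ) (fun _ _ => Finset.mem_univ _),
    Finset.sum_const_nat (m := n), mul_comm]
  intro b _
  obtain ⟨x, rfl⟩ := hg b
  exact h x

lemma matchingEdges_mk_eq_iff {s : C → C} (hs : ∀ x, s (s x) = x) (x y : C) :
    (Quot.mk _ y : MatchingEdges s) = Quot.mk _ x ↔ y = x ∨ y = s x := by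
  constructor
  · intro h
    have hp : ∀ y w, w = s y → (y = x ∨ y = s x) = (w = x ∨ w = s x) := by
      rintro y _ rfl
      refine propext ⟨?_, ?_⟩
      · rintro (rfl | rfl)
        · exact Or.inr rfl
        · exact Or.inl (hs x)
      · rintro (rfl | h)
        · exact Or.inr (hs y).symm
        · exact Or.inl (by rw [← hs y, h, hs])
    exact cast (congrArg (Quot.lift _ hp) h).symm (Or.inl rfl)
  · rintro (rfl | rfl)
    · rfl
    · exact (Quot.sound (r := fun x y => y = s x) rfl).symm

lemma card_matchingEdges [Finite C] {s : C → C} (hs : ∀ x, s (s x) = x) (hne : ∀ x, s x ≠ x) :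
    Nat.card C = 2 * Nat.card (MatchingEdges s) := by
  classical
  have := Fintype.ofFinite C
  refine card_eq_mul_of_card_fiber (fun x => (Quot.mk _ x : MatchingEdges s)) Quot.mk_surjective 2
    fun x => ?_
  rw [← Finset.card_pair (hne x).symm]
  congr 1
  ext y
  simp [matchingEdges_mk_eq_iff hs]

lemma card_eq_four_mul [Finite C] [Finite E] (M : CombMap C E) :
    Nat.card C = 4 * Nat.card E := by
  classical
  have := Fintype.ofFinite C
  refine card_eq_mul_of_card_fiber M.edge M.edge_surj 4 fun x => ?_
  have h : (Finset.univ.filter fun y => M.edge y = M.edge x) = {x, M.v x, M.f x, M.z x} := by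
    ext y
    simp only [Finset.mem_filter, Finset.mem_univ, true_and, Finset.mem_insert,
      Finset.mem_singleton]
    exact eq_comm.trans (M.edge_eq x y)
  have h₁ : M.v x ≠ M.z x := fun h => M.f_ne x (by rw [← M.v_z, ← h, M.v_invol])
  have h₂ : M.f x ≠ M.z x := fun h => M.v_ne x (by rw [← M.f_z, ← h, M.f_invol])
  simp [h, (M.v_ne x).symm, (M.f_ne x).symm, (M.z_ne x).symm, M.v_ne_f x, h₁, h₂]

lemma card_squares (M : CombMap C E) : Nat.card (PolygonSet M.v M.f) = Nat.card E := by
  have hlift : ∀ x y, (y = M.v x ∨ y = M.f x) → M.edge x = M.edge y := by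
    rintro x _ (rfl | rfl)
    · rw [edge_v]
    · rw [edge_f]
  have hv : ∀ x, (Quot.mk _ (M.v x) : PolygonSet M.v M.f) = Quot.mk _ x := fun x =>
    (Quot.sound (r := fun x y => y = M.v x ∨ y = M.f x) (Or.inl rfl)).symm
  have hf : ∀ x, (Quot.mk _ (M.f x) : PolygonSet M.v M.f) = Quot.mk _ x := fun x =>
    (Quot.sound (r := fun x y => y = M.v x ∨ y = M.f x) (Or.inr rfl)).symm
  refine Nat.card_eq_of_bijective (Quot.lift M.edge hlift) ⟨?_, fun e => ?_⟩
  · intro p q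
    induction p using Quot.ind with
    | _ x =>
      induction q using Quot.ind with
      | _ y =>
        intro h
        rcases M.eq_of_edge_eq (x := x) (y := y) h.symm with rfl | rfl | rfl | rfl
        · rfl
        · exact (hv x).symm
        · exact (hf x).symm
        · exact ((hv _).trans (hf x)).symm
  · obtain ⟨x, rfl⟩ := M.edge_surj e
    exact ⟨Quot.mk _ x, rfl⟩

lemma connectivity_eq [Finite C] [Finite E] (M : CombMap C E) :
    M.connectivity = (Nat.card E : ℤ) + 2 - Nat.card M.VGon - Nat.card M.FGon := by
  have h₀ := M.card_eq_four_mul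
  have h₁ := card_matchingEdges M.v_invol M.v_ne
  have h₂ := card_matchingEdges M.f_invol M.f_ne
  have h₃ := card_matchingEdges M.a_invol M.a_ne
  have h₄ := M.card_squares
  have c₀ : Nat.card (M.SurfCell 0) = Nat.card C := rfl
  have c₁ : Nat.card (M.SurfCell 1) =
      Nat.card (MatchingEdges M.v) + (Nat.card (MatchingEdges M.f) +
        Nat.card (MatchingEdges M.a)) := by
    change Nat.card (_ ⊕ _ ⊕ _) = _
    rw [Nat.card_sum, Nat.card_sum]
  have c₂ : Nat.card (M.SurfCell 2) =
      Nat.card M.VGon + (Nat.card M.FGon + Nat.card (PolygonSet M.v M.f)) := by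
    change Nat.card (_ ⊕ _ ⊕ _) = _
    rw [Nat.card_sum, Nat.card_sum]
  rw [connectivity, surfEulerChar, Fin.sum_univ_three, c₀, c₁, c₂]
  push_cast
  norm_num
  omega

/-! ### The composite map -/

lemma HasOneZGon.dual_cPhial_comm [Finite C] [Fintype E] {M : CombMap C E} (hM : M.HasOneZGon)
    (X : E → ZMod 2) : M.dual.cPhial (M.cPhial X) = M.cPhial (M.dual.cPhial X) := by
  have h : ∀ Y, M.dual.cPhial Y = Y - M.cPhial Y := fun Y =>
    eq_sub_of_add_eq' (hM.cPhial_add_dual_cPhial Y)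
  rw [h, h, map_sub]

/-- As `c_P` and `c_{P~}` commute and add up to the identity, the kernel of their product is the sum
of their kernels. -/
lemma HasOneZGon.ker_comp [Finite C] [Fintype E] {M : CombMap C E} (hM : M.HasOneZGon) :
    LinearMap.ker (M.dual.cPhial ∘ₗ M.cPhial) =
      LinearMap.ker M.cPhial ⊔ LinearMap.ker M.dual.cPhial := by
  apply le_antisymm
  · intro X hX
    have hX' : M.dual.cPhial (M.cPhial X) = 0 := hX
    rw [← hM.cPhial_add_dual_cPhial X, add_comm]
    exact Submodule.add_mem_sup ((hM.dual_cPhial_comm X).symm.trans hX') hX'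
  · refine sup_le ?_ ?_
    · intro X hX
      rw [LinearMap.mem_ker, LinearMap.comp_apply, LinearMap.mem_ker.1 hX, map_zero]
    · intro X hX
      rw [LinearMap.mem_ker, LinearMap.comp_apply, hM.dual_cPhial_comm, LinearMap.mem_ker.1 hX,
        map_zero]

lemma HasOneZGon.ker_inf_ker [Finite C] [Fintype E] {M : CombMap C E} (hM : M.HasOneZGon) :
    LinearMap.ker M.cPhial ⊓ LinearMap.ker M.dual.cPhial = ⊥ := by
  refine (Submodule.eq_bot_iff _).2 fun X hX => ?_
  rw [← hM.cPhial_add_dual_cPhial X, LinearMap.mem_ker.1 hX.1, LinearMap.mem_ker.1 hX.2, add_zero]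

lemma HasOneZGon.sum_mul_comp [Finite C] [Fintype E] {M : CombMap C E} (hM : M.HasOneZGon)
    (X Y : E → ZMod 2) : ∑ e, Y e * (M.dual.cPhial ∘ₗ M.cPhial) X e =
      ∑ e, X e * (M.dual.cPhial ∘ₗ M.cPhial) Y e := by
  simp only [LinearMap.comp_apply]
  rw [hM.dual.sum_mul_cPhial (M.cPhial X) Y, hM.dual_cPhial_comm, ← hM.sum_mul_cPhial X]
  exact Finset.sum_congr rfl fun _ _ => mul_comm _ _

/-- The range of a self-adjoint map is the orthogonal complement of its kernel. -/
lemma mem_range_iff_of_selfAdjoint {K E : Type*} [Field K] [Fintype E]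
    (T : (E → K) →ₗ[K] (E → K)) (hT : ∀ X Y, ∑ e, Y e * T X e = ∑ e, X e * T Y e) (X : E → K) :
    X ∈ LinearMap.range T ↔ ∀ Y ∈ LinearMap.ker T, ∑ e, X e * Y e = 0 := by
  classical
  constructor
  · rintro ⟨Z, rfl⟩ Y hY
    simp only [mul_comm (T Z _), hT Z Y, LinearMap.mem_ker.1 hY, Pi.zero_apply, mul_zero,
      Finset.sum_const_zero]
  · intro h
    set ℓ : Module.Dual K (E → K) := ∑ e, X e • LinearMap.proj e with hℓ
    have hℓ_apply : ∀ Y, ℓ Y = ∑ e, X e * Y e := fun Y => by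
      simp [hℓ, LinearMap.sum_apply]
    have hmem : ℓ ∈ LinearMap.range T.dualMap := by
      rw [LinearMap.range_dualMap_eq_dualAnnihilator_ker, Submodule.mem_dualAnnihilator]
      intro Y hY
      rw [hℓ_apply, h Y hY]
    obtain ⟨m, hm⟩ := hmem
    have hm_apply : ∀ Y, m Y = ∑ e, m (Pi.single e 1) * Y e := by
      intro Y
      conv_lhs => rw [pi_eq_sum_univ' Y]
      simp only [map_sum, map_smul, smul_eq_mul]
      exact Finset.sum_congr rfl fun e _ => mul_comm _ _
    refine ⟨fun e => m (Pi.single e 1), ?_⟩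
    funext e
    have h₁ : ℓ (Pi.single e 1) = m (T (Pi.single e 1)) := by rw [← hm]; rfl
    rw [hℓ_apply, hm_apply, hT] at h₁
    simpa [Pi.single_apply] using h₁.symm

end CombMap

theorem theorem3 {C E : Type*} [Fintype C] [Fintype E] (M : CombMap C E) (hM : M.HasOneZGon) :
    ((Module.finrank (ZMod 2) (LinearMap.range (M.dual.cPhial ∘ₗ M.cPhial)) : ℤ) = M.connectivity ∧
      M.connectivity =
        (Fintype.card E : ℤ) + 2 - (Nat.card M.VGon : ℤ) - (Nat.card M.FGon : ℤ)) ∧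
    LinearMap.range (M.dual.cPhial ∘ₗ M.cPhial) =
      cycleSpace M.inducedGraph ⊓ cycleSpace M.dual.inducedGraph ∧
    LinearMap.ker (M.dual.cPhial ∘ₗ M.cPhial) =
      bondSpace M.inducedGraph ⊔ bondSpace M.dual.inducedGraph := by
  have hker := hM.ker_comp
  rw [hM.ker_cPhial, hM.dual.ker_cPhial] at hker
  have hξ := M.connectivity_eq
  rw [Nat.card_eq_fintype_card] at hξ
  refine ⟨⟨?_, hξ⟩, ?_, hker⟩
  · have h₁ := LinearMap.finrank_range_add_finrank_ker (M.dual.cPhial ∘ₗ M.cPhial)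
    have h₂ := Submodule.finrank_sup_add_finrank_inf_eq (bondSpace M.inducedGraph)
      (bondSpace M.dual.inducedGraph)
    have hdisj := hM.ker_inf_ker
    rw [hM.ker_cPhial, hM.dual.ker_cPhial] at hdisj
    rw [hdisj, finrank_bot] at h₂
    rw [hker, Module.finrank_fintype_fun_eq_card] at h₁
    have h₃ := M.finrank_bondSpace_inducedGraph
    have h₄ : _ = Nat.card M.FGon := M.dual.finrank_bondSpace_inducedGraph
    omega
  · ext X
    rw [CombMap.mem_range_iff_of_selfAdjoint _ hM.sum_mul_comp, hker, Submodule.mem_inf,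
      M.mem_cycleSpace_inducedGraph, M.dual.mem_cycleSpace_inducedGraph]
    constructor
    · exact fun h => ⟨fun Y hY => h Y (Submodule.mem_sup_left hY),
        fun Y hY => h Y (Submodule.mem_sup_right hY)⟩
    · rintro ⟨h₁, h₂⟩ Y hY
      obtain ⟨A, hA, B, hB, rfl⟩ := Submodule.mem_sup.1 hY
      simp only [Pi.add_apply, mul_add, Finset.sum_add_distrib, h₁ A hA, h₂ B hB, add_zero]
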